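/- Let $\mathbb{N}=\{1,2,3,\dots\}$ and let $\mathbb{K}=\mathbb{R}$ or $\mathbb{C}$. For $A\subseteq\mathbb{N}\cup\{0\}$ put $$\underline{\mathrm{dens}}\,A=\liminf_{M\to\infty}\frac{|A\cap[1,M]|}{M},\qquad \overline{\mathrm{dens}}\,A=\limsup_{M\to\infty}\frac{|A\cap[1,M]|}{M},\qquad \overline{\mathrm{Bd}}\,A=\limsup_{M\to\infty}\max_{k\ge1}\frac{|A\cap[k+1,k+M]|}{M},$$ and let $\mathcal{A}_{ld},\mathcal{A}_{ud},\mathcal{A}_{uBd}$ be the families of sets $A$ with $\underline{\mathrm{dens}}\,A>0$, $\overline{\mathrm{dens}}\,A>0$, $\overline{\mathrm{Bd}}\,A>0$ respectively. Let $N\ge2$ and $[l]=\{1,\dots,l\}$. *Disjoint $\mathcal{A}$-hypercyclicity.* Bounded operators $T_1,\dots,T_N$ on a Banach space $X$ are disjoint $\mathcal{A}$-hypercyclic if there is $x\in X$ such that $\{n\ge0:(T_1^nx,\dots,T_N^nx)\in U\}\in\mathcal{A}$ for every non-empty open $U\subseteq X^N$. *Disjoint $\mathcal{A}$-Hypercyclicity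 Criterion.* $T_1,\dots,T_N$ satisfy the criterion if there exist a dense set $Y_0\subseteq X$, a sequence $(y_l)_{l\ge1}$ dense in $Y_0^N$, with $y_l=(y_{l,j})_{j\in[N]}$, maps $S_n:Y_0^N\to X$ $(n\ge0)$, pairwise disjoint sets $A_k\in\mathcal{A}$ $(k\ge1)$ and positive reals $\varepsilon_k\to0$ such that for every $l\ge1$ and $j\in[N]$: 1. $\sum_{n\in A_l}S_ny_l$ converges unconditionally, uniformly in $l$; that is, for every $\delta>0$ there is $M$ such that $\bigl\|\sum_{n\in F}S_ny_l\bigr\|\le\delta$ for all $l$ and all finite $F\subseteq A_l\cap[M,\infty)$; 2. $\bigl\|\sum_{i\in A_l\setminus\{n\}}T_j^nS_iy_l\bigr\|\le\varepsilon_l$ for all $n\in\bigcup_{k\ge1}A_k$; 3. $\bigl\|\sum_{i\in A_k}T_j^nS_iy_k\bigr\|\le\varepsilon_l$ for all $n\in A_l$ and all $k<l$; 4. $\|T_j^nS_ny_l-y_{l,j}\|\le\varepsilon_l$ for all $n\in A_l$. *Weak partition regularity.* Given maps $f_s:\mathbb{N}\to\mathbb{N}$, $s\in[N]$, the family $\mathcal{A}$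 is $(f_s)_{s=1}^N$-weakly partition regular if for every sequence $(B_l)_{l\ge1}$ in $\mathcal{A}$ there is a sequence $(A_l)_{l\ge1}$ in $\mathcal{A}$ with $A_l\subseteq B_l$ for all $l$ and $$f_s^m([l])\cap f_t^n([k])=\emptyset\qquad\text{for all } l,k\ge1,\ m\in A_l,\ n\in A_k,\ m\ne n,\ s,t\in[N],$$ where $f_s^m$ denotes the $m$-th iterate. **Corollary.** For $s\in[N]$ let $f_s:\mathbb{N}\to\mathbb{N}$ be strictly increasing with $f_s(1)>1$, and let $w_s=(w_{s,j})_{j\ge1}$ be scalars in $\mathbb{K}$ with $\sup_j|w_{s,f_s(j)}|<\infty$. Let $X=c_0(\mathbb{N})$ or $X=\ell^p(\mathbb{N})$ with $1\le p<\infty$, and let $T_{f_s,w_s}:X\to X$ be the unilateral pseudo-shift $$T_{f_s,w_s}\Bigl(\sum_{j\ge1}x_je_j\Bigr)=\sum_{j\ge1}w_{s,f_s(j)}x_{f_s(j)}e_j .$$ Let $\mathcal{A}\in\{\mathcal{A}_{uBd},\mathcal{A}_{ud},\mathcal{A}_{ld}\}$ be $(f_s)_{s=1}^N$-weakly partition regular.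 Then $T_{f_1,w_1},\dots,T_{f_N,w_N}$ are disjoint $\mathcal{A}$-hypercyclic if and only if they satisfy the Disjoint $\mathcal{A}$-Hypercyclicity Criterion. -/

import Mathlib

open Filter Topology
open scoped ENNReal ZeroAtInfty

noncomputable section

/-! ### Densities of sets of natural numbers -/

/-- `liminf_N card {1 ≤ n ≤ N : n ∈ A} / N`. -/
def lowerDensity (A : Set ℕ) : ℝ :=
  liminf (fun N : ℕ => ((A ∩ Set.Icc 1 N).ncard : ℝ) / N) atTop

/-- `limsup_N card {1 ≤ n ≤ N : n ∈ A} / N`. -/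
def upperDensity (A : Set ℕ) : ℝ :=
  limsup (fun N : ℕ => ((A ∩ Set.Icc 1 N).ncard : ℝ) / N) atTop

/-- `limsup_N max_{k ≥ 1} card (A ∩ [k+1, k+N]) / N`. -/
def upperBanachDensity (A : Set ℕ) : ℝ :=
  limsup (fun N : ℕ => ⨆ k : ℕ+, ((A ∩ Set.Icc ((k : ℕ) + 1) (k + N)).ncard : ℝ) / N) atTop

/-- Sets of positive lower density. -/
def familyLd : Set (Set ℕ) := {A | 0 < lowerDensity A}

/-- Sets of positive upper density. -/
def familyUd : Set (Set ℕ) := {A | 0 < upperDensity A}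

/-- Sets of positive upper Banach density. -/
def familyUBd : Set (Set ℕ) := {A | 0 < upperBanachDensity A}

/-! ### (Disjoint) `𝒜`-hypercyclicity -/

section Dynamics

variable {𝕜 : Type*} [RCLike 𝕜] {X : Type*} [NormedAddCommGroup X] [NormedSpace 𝕜 X]

/-- `x` is an `𝒜`-hypercyclic vector for the operator `T` (on a topological vector space). -/
def IsAHypercyclicVector {E : Type*} [AddCommGroup E] [Module 𝕜 E] [TopologicalSpace E]
    (𝒜 : Set (Set ℕ)) (T : E →L[𝕜] E) (x : E) : Prop :=
  ∀ U : Set E, IsOpen U → U.Nonempty → {n : ℕ | (T ^ n) x ∈ U} ∈ 𝒜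

/-- The operator `T₁ ⊕ ⋯ ⊕ T_N` on `X ^ N`, `(x_s)_s ↦ (T_s x_s)_s`. -/
def directSumOp {N : ℕ} (T : Fin N → X →L[𝕜] X) : (Fin N → X) →L[𝕜] (Fin N → X) :=
  ContinuousLinearMap.pi fun s => (T s).comp (ContinuousLinearMap.proj s)

/-- `T₁, …, T_N` are disjoint `𝒜`-hypercyclic. -/
def DisjointAHypercyclic {N : ℕ} (𝒜 : Set (Set ℕ)) (T : Fin N → X →L[𝕜] X) : Prop :=
  ∃ x : X, IsAHypercyclicVector 𝒜 (directSumOp T) (fun _ => x)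

/-- `T₁, …, T_N` satisfy the Disjoint `𝒜`-Hypercyclicity Criterion. In the clause `unif`, which
says that the series `∑_{n ∈ A_l} S_n y_l` converge unconditionally, uniformly in `l`, `F` runs
over all finite sets of indices `≥ M`. The other infinite sums converge unconditionally because of
that clause, so `∑'` is the actual sum. -/
def SatisfiesDisjointACriterion {N : ℕ} (𝒜 : Set (Set ℕ)) (T : Fin N → X →L[𝕜] X) : Prop :=
  ∃ (Y₀ : Set X) (y : ℕ → Fin N → Y₀) (S : ℕ → (Fin N → Y₀) → X) (A : ℕ → Set ℕ) (ε : ℕ → ℝ),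
    Dense Y₀ ∧ DenseRange y ∧
    (∀ k, A k ∈ 𝒜) ∧ (∀ k l, k ≠ l → Disjoint (A k) (A l)) ∧
    (∀ k, 0 < ε k) ∧ Tendsto ε atTop (𝓝 0) ∧
    -- `unif`
    (∀ δ : ℝ, 0 < δ → ∃ M : ℕ, ∀ l : ℕ, ∀ F : Finset ℕ, (∀ n ∈ F, M ≤ n ∧ n ∈ A l) →
      ‖∑ n ∈ F, S n (y l)‖ ≤ δ) ∧
    (∀ l : ℕ, ∀ j : Fin N, ∀ n ∈ ⋃ k, A k,
      ‖∑' i : (A l \ {n} : Set ℕ), (T j ^ n) (S i (y l))‖ ≤ ε l) ∧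
    (∀ l : ℕ, ∀ j : Fin N, ∀ n ∈ A l, ∀ k < l,
      ‖∑' i : A k, (T j ^ n) (S i (y k))‖ ≤ ε l) ∧
    (∀ l : ℕ, ∀ j : Fin N, ∀ n ∈ A l, ‖(T j ^ n) (S n (y l)) - (y l j : X)‖ ≤ ε l)

end Dynamics

/-! ### Weak partition regularity

Coordinates are numbered `0, 1, 2, …` instead of `1, 2, 3, …`, so that the initial segment
`[l] = {1, …, l}` becomes `Set.Iio l = {0, …, l - 1}`. (The index `l = 0`, with its empty segment,
adds no condition beyond `A 0 ⊆ B 0`.) -/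

/-- The family `𝒜` is `(f_s)`-weakly partition regular. -/
def WeaklyPartitionRegular {N : ℕ} (f : Fin N → ℕ → ℕ) (𝒜 : Set (Set ℕ)) : Prop :=
  ∀ B : ℕ → Set ℕ, (∀ l, B l ∈ 𝒜) →
    ∃ A : ℕ → Set ℕ, (∀ l, A l ∈ 𝒜) ∧ (∀ l, A l ⊆ B l) ∧
      ∀ l k : ℕ, ∀ m ∈ A l, ∀ n ∈ A k, m ≠ n → ∀ s t : Fin N,
        ((f s)^[m] '' Set.Iio l) ∩ ((f t)^[n] '' Set.Iio k) = ∅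

/-! ### Unilateral pseudo-shifts on `ℓ^p` and `c₀`

Both operators are `(x_j)_j ↦ (w_{f(j)} x_{f(j)})_j`. The weights are bounded along `f`, which is
what it takes for this formula to define a bounded operator. -/

section PseudoShift

variable {𝕜 : Type*} [RCLike 𝕜]

theorem exists_weight_bound {f : ℕ → ℕ} {w : ℕ → 𝕜}
    (hw : BddAbove (Set.range fun j => ‖w (f j)‖)) :
    ∃ C : ℝ, 0 ≤ C ∧ ∀ j, ‖w (f j)‖ ≤ C := by
  obtain ⟨C, hC⟩ := hw
  have h : ∀ j, ‖w (f j)‖ ≤ C := fun j => hC ⟨j, rfl⟩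
  exact ⟨C, (norm_nonneg _).trans (h 0), h⟩

theorem summable_pseudoShift {p : ℝ} (hp : 0 < p) {f : ℕ → ℕ} (hf : StrictMono f) {w : ℕ → 𝕜}
    {C : ℝ} (hC0 : 0 ≤ C) (hC : ∀ j, ‖w (f j)‖ ≤ C) {x : ℕ → 𝕜}
    (hx : Summable fun j => ‖x j‖ ^ p) :
    (Summable fun j => ‖w (f j) * x (f j)‖ ^ p) ∧
      ∑' j, ‖w (f j) * x (f j)‖ ^ p ≤ C ^ p * ∑' j, ‖x j‖ ^ p := by
  have hle : ∀ j, ‖w (f j) * x (f j)‖ ^ p ≤ C ^ p * ‖x (f j)‖ ^ p := by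
    intro j
    rw [norm_mul, Real.mul_rpow (norm_nonneg _) (norm_nonneg _)]
    have := Real.rpow_le_rpow (norm_nonneg _) (hC j) hp.le
    gcongr
  have hxf : Summable fun j => ‖x (f j)‖ ^ p := hx.comp_injective hf.injective
  have hs : Summable fun j => ‖w (f j) * x (f j)‖ ^ p :=
    Summable.of_nonneg_of_le (fun j => by positivity) hle (hxf.mul_left _)
  refine ⟨hs, (hs.tsum_le_tsum hle (hxf.mul_left _)).trans ?_⟩
  rw [tsum_mul_left]
  have : ∑' j, ‖x (f j)‖ ^ p ≤ ∑' j, ‖x j‖ ^ p :=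
    tsum_comp_le_tsum_of_inj hx (fun j => by positivity) hf.injective
  gcongr

/-- The pseudo-shift `T_{f,w}` on `ℓ^p(ℕ)`, `1 ≤ p < ∞`. -/
def lpPseudoShift (p : ℝ≥0∞) [hp1 : Fact (1 ≤ p)] (hp : p ≠ ⊤) (f : ℕ → ℕ) (hf : StrictMono f)
    (w : ℕ → 𝕜) (hw : BddAbove (Set.range fun j => ‖w (f j)‖)) :
    lp (fun _ : ℕ => 𝕜) p →L[𝕜] lp (fun _ : ℕ => 𝕜) p :=
  have hpos : 0 < p.toReal := ENNReal.toReal_pos (zero_lt_one.trans_le hp1.out).ne' hp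
  LinearMap.mkContinuousOfExistsBound
    { toFun := fun x => ⟨fun j => w (f j) * x (f j), by
        obtain ⟨C, hC0, hC⟩ := exists_weight_bound hw
        exact (memℓp_gen_iff hpos).2
          (summable_pseudoShift hpos hf hC0 hC ((memℓp_gen_iff hpos).1 (lp.memℓp x))).1⟩
      map_add' := fun x y => by
        ext j
        exact mul_add _ _ _
      map_smul' := fun c x => by
        ext j
        exact mul_left_comm _ _ _ }
    (by
      obtain ⟨C, hC0, hC⟩ := exists_weight_bound hw
      refine ⟨C, fun x => lp.norm_le_of_tsum_le hpos (by positivity) ?_⟩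
      rw [Real.mul_rpow hC0 (norm_nonneg _), lp.norm_rpow_eq_tsum hpos x]
      exact (summable_pseudoShift hpos hf hC0 hC ((memℓp_gen_iff hpos).1 (lp.memℓp x))).2)

theorem lpPseudoShift_apply (p : ℝ≥0∞) [Fact (1 ≤ p)] (hp : p ≠ ⊤) (f : ℕ → ℕ)
    (hf : StrictMono f) (w : ℕ → 𝕜) (hw : BddAbove (Set.range fun j => ‖w (f j)‖))
    (x : lp (fun _ : ℕ => 𝕜) p) (j : ℕ) :
    lpPseudoShift p hp f hf w hw x j = w (f j) * x (f j) := rfl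

/-- The pseudo-shift `T_{f,w}` on `c₀(ℕ)`; `C₀(ℕ, 𝕜)` is the space of null sequences with the
supremum norm. -/
def c0PseudoShift (f : ℕ → ℕ) (hf : StrictMono f)
    (w : ℕ → 𝕜) (hw : BddAbove (Set.range fun j => ‖w (f j)‖)) :
    C₀(ℕ, 𝕜) →L[𝕜] C₀(ℕ, 𝕜) :=
  LinearMap.mkContinuousOfExistsBound
    { toFun := fun x =>
        { toFun := fun j => w (f j) * x (f j)
          continuous_toFun := continuous_of_discreteTopology
          zero_at_infty' := by
            obtain ⟨C, hC0, hC⟩ := exists_weight_bound hw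
            have hx : Tendsto (fun j => C * ‖x (f j)‖) (cocompact ℕ) (𝓝 0) := by
              have h := (zero_at_infty x).norm.const_mul C
              rw [norm_zero, mul_zero] at h
              rw [cocompact_eq_cofinite, Nat.cofinite_eq_atTop] at h ⊢
              exact h.comp hf.tendsto_atTop
            refine squeeze_zero_norm (fun j => ?_) hx
            rw [norm_mul]
            exact mul_le_mul_of_nonneg_right (hC j) (norm_nonneg _) }
      map_add' := fun x y => by
        ext j
        exact mul_add _ _ _
      map_smul' := fun c x => by
        ext j
        exact mul_left_comm _ _ _ }
    (by
      obtain ⟨C, hC0, hC⟩ := exists_weight_bound hw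
      refine ⟨C, fun x => ?_⟩
      rw [← ZeroAtInftyContinuousMap.norm_toBCF_eq_norm]
      refine (BoundedContinuousFunction.norm_le (by positivity)).2 fun j => ?_
      have h1 : ‖x (f j)‖ ≤ ‖x‖ := by
        rw [← ZeroAtInftyContinuousMap.norm_toBCF_eq_norm]
        exact x.toBCF.norm_coe_le_norm (f j)
      have h2 : ‖w (f j) * x (f j)‖ ≤ C * ‖x‖ := by
        rw [norm_mul]
        exact mul_le_mul (hC j) h1 (norm_nonneg _) hC0
      exact h2)

theorem c0PseudoShift_apply (f : ℕ → ℕ) (hf : StrictMono f)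
    (w : ℕ → 𝕜) (hw : BddAbove (Set.range fun j => ‖w (f j)‖)) (x : C₀(ℕ, 𝕜)) (j : ℕ) :
    c0PseudoShift f hf w hw x j = w (f j) * x (f j) := rfl

end PseudoShift

end

/-! ### The density families -/

/-! Sufficiency holds in every nontrivial Banach space. The vectors ξ_l = ∑_{n ∈ A_l} S_n y_l tend
to 0, because disjoint sets A_l escape to infinity and the series converge uniformly in l. A sparse
subseries x = ∑ ξ_{φ k} therefore converges, and for n ∈ A_{φ k} each T_j^n moves its k-th term
close to y_{φ k, j} and the others close to 0 (`norm_tsum_sub_le_of_geometric`). Every return set of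
x then contains some A_{φ k}.

For necessity, let x be a disjoint hypercyclic vector and (y_l) a dense sequence of nonzero tuples
of finitely supported vectors. Let B_l be the set of times at which (T_j^n x)_j is ε_l-close to C_l
y_l, with large C_l. Weak partition regularity thins B_l to A_l so that the blocks D_{l,n} = ⋃_t
f_t^n([L_l]) are disjoint for distinct n; put S_n y_l = C_l⁻¹ · (x restricted to D_{l,n}). By
`pow_pseudoShift_restrict`, T_j^n turns restriction to D into restriction to the preimage of D under
f_j^n. Hence for n ∈ A_l the block of n reproduces y_l, while for n ∈ A_k all other blocks only see
the error T_j^n x − C_k y_{k,j}.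

Of the density families only upward closure and ∅ ∉ 𝒜 are used. Of the space, only contractive
coordinate restrictions and vanishing tails enter this direction, so `SequenceSpace` treats `c₀` and
`ℓ^p` together. -/

theorem ncard_inter_Icc_div_le_one (A : Set ℕ) (k M : ℕ) :
    ((A ∩ Set.Icc (k + 1) (k + M)).ncard : ℝ) / M ≤ 1 := by
  refine div_le_one_of_le₀ ?_ (Nat.cast_nonneg _)
  have h := Set.ncard_le_ncard (Set.inter_subset_right (s := A) (t := Set.Icc (k + 1) (k + M)))
    (Set.finite_Icc _ _)
  rw [← Finset.coe_Icc, Set.ncard_coe_finset, Nat.card_Icc] at h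
  exact_mod_cast h.trans (by omega)

theorem ncard_inter_Icc_div_mono {A B : Set ℕ} (h : A ⊆ B) (a b M : ℕ) :
    ((A ∩ Set.Icc a b).ncard : ℝ) / M ≤ ((B ∩ Set.Icc a b).ncard : ℝ) / M := by
  have := Set.ncard_le_ncard (Set.inter_subset_inter_left (Set.Icc a b) h)
    ((Set.finite_Icc a b).inter_of_right B)
  gcongr

theorem isBoundedUnder_le_of_le {u : ℕ → ℝ} {c : ℝ} (h : ∀ n, u n ≤ c) :
    IsBoundedUnder (· ≤ ·) atTop u := isBoundedUnder_of ⟨c, h⟩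

theorem isBoundedUnder_ge_of_ge {u : ℕ → ℝ} {c : ℝ} (h : ∀ n, c ≤ u n) :
    IsBoundedUnder (· ≥ ·) atTop u := isBoundedUnder_of ⟨c, h⟩

/-- Comparing real `liminf` and `limsup` requires bounded sequences; the quotients lie in [0, 1]. -/
theorem lowerDensity_mono {A B : Set ℕ} (h : A ⊆ B) : lowerDensity A ≤ lowerDensity B := by
  refine liminf_le_liminf (Eventually.of_forall fun M => ncard_inter_Icc_div_mono h 1 M M)
    (isBoundedUnder_ge_of_ge (c := 0) fun M => by positivity)
    (isBoundedUnder_le_of_le (c := 1) fun M => ?_).isCoboundedUnder_ge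
  simpa using ncard_inter_Icc_div_le_one B 0 M

theorem upperDensity_mono {A B : Set ℕ} (h : A ⊆ B) : upperDensity A ≤ upperDensity B := by
  refine limsup_le_limsup (Eventually.of_forall fun M => ncard_inter_Icc_div_mono h 1 M M)
    (isBoundedUnder_ge_of_ge (c := 0) fun M => by positivity).isCoboundedUnder_le
    (isBoundedUnder_le_of_le (c := 1) fun M => ?_)
  simpa using ncard_inter_Icc_div_le_one B 0 M

theorem upperBanachDensity_mono {A B : Set ℕ} (h : A ⊆ B) :
    upperBanachDensity A ≤ upperBanachDensity B := by
  refine limsup_le_limsup (Eventually.of_forall fun M => ?_)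
    (isBoundedUnder_ge_of_ge (c := 0) fun M => ?_).isCoboundedUnder_le
    (isBoundedUnder_le_of_le (c := 1) fun M => ?_)
  · refine ciSup_mono ⟨1, ?_⟩ fun k => ncard_inter_Icc_div_mono h _ _ M
    rintro _ ⟨k, rfl⟩
    exact ncard_inter_Icc_div_le_one B k M
  · exact Real.iSup_nonneg fun k => by positivity
  · exact ciSup_le fun k => ncard_inter_Icc_div_le_one B k M

theorem mem_density_family_mono {𝒜 : Set (Set ℕ)}
    (h𝒜 : 𝒜 = familyUBd ∨ 𝒜 = familyUd ∨ 𝒜 = familyLd) {A B : Set ℕ} (hA : A ∈ 𝒜) (h : A ⊆ B) :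
    B ∈ 𝒜 := by
  rcases h𝒜 with rfl | rfl | rfl
  · exact lt_of_lt_of_le hA (upperBanachDensity_mono h)
  · exact lt_of_lt_of_le hA (upperDensity_mono h)
  · exact lt_of_lt_of_le hA (lowerDensity_mono h)

theorem empty_notMem_density_family {𝒜 : Set (Set ℕ)}
    (h𝒜 : 𝒜 = familyUBd ∨ 𝒜 = familyUd ∨ 𝒜 = familyLd) : ∅ ∉ 𝒜 := by
  rcases h𝒜 with rfl | rfl | rfl
  · simp [familyUBd, upperBanachDensity]
  · simp [familyUd, upperDensity]
  · simp [familyLd, lowerDensity]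

/-! ### Generalities on operators and series -/

section General

variable {𝕜 : Type*} [RCLike 𝕜] {X : Type*} [NormedAddCommGroup X] [NormedSpace 𝕜 X]

theorem directSumOp_pow_apply {N : ℕ} (T : Fin N → X →L[𝕜] X) (n : ℕ) (v : Fin N → X) :
    (directSumOp T ^ n) v = fun s => (T s ^ n) (v s) := by
  induction n generalizing v with
  | zero => rfl
  | succ n ih =>
    rw [pow_succ, mul_apply_eq_comp, ih]
    funext s
    rw [pow_succ, mul_apply_eq_comp]
    rfl

theorem norm_tsum_le_of_forall_norm_sum_le {ι : Type*} {g : ι → X} {c : ℝ}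
    (h : ∀ F : Finset ι, ‖∑ i ∈ F, g i‖ ≤ c) : ‖∑' i, g i‖ ≤ c := by
  by_cases hg : Summable g
  · exact le_of_tendsto' hg.hasSum.norm h
  · rw [tsum_eq_zero_of_not_summable hg, norm_zero]
    -- A divergent series has `tsum` 0, and the empty sum gives `0 ≤ c`.
    simpa using h ∅

theorem norm_tsum_subtype_le {B : Set ℕ} {g : ℕ → X} {c : ℝ}
    (h : ∀ F : Finset ℕ, (∀ n ∈ F, n ∈ B) → ‖∑ n ∈ F, g n‖ ≤ c) :
    ‖∑' i : B, g i‖ ≤ c := by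
  refine norm_tsum_le_of_forall_norm_sum_le fun F => ?_
  have := h (F.map (Function.Embedding.subtype _)) (by simp +contextual)
  simpa using this

theorem summable_subtype_of_tail [CompleteSpace X] {B : Set ℕ} {g : ℕ → X}
    (h : ∀ δ : ℝ, 0 < δ → ∃ M : ℕ, ∀ F : Finset ℕ, (∀ n ∈ F, M ≤ n ∧ n ∈ B) →
      ‖∑ n ∈ F, g n‖ ≤ δ) : Summable fun i : B => g i := by
  classical
  refine summable_iff_vanishing_norm.2 fun δ hδ => ?_
  obtain ⟨M, hM⟩ := h (δ / 2) (half_pos hδ)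
  refine ⟨Finset.subtype (· ∈ B) (Finset.range M), fun F hF => ?_⟩
  refine lt_of_le_of_lt ?_ (half_lt_self hδ)
  have := hM (F.map (Function.Embedding.subtype _)) fun n hn => by
    obtain ⟨i, hi, rfl⟩ := Finset.mem_map.1 hn
    refine ⟨?_, i.2⟩
    by_contra hlt
    exact Finset.disjoint_left.1 hF hi (by simpa using hlt)
  simpa using this

theorem tsum_subtype_eq_add_tsum_diff [CompleteSpace X] {B : Set ℕ} {g : ℕ → X} {n : ℕ}
    (hn : n ∈ B) (hg : Summable fun i : B => g i) :
    ∑' i : B, g i = g n + ∑' i : (B \ {n} : Set ℕ), g i := by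
  have hd : Summable fun i : (B \ {n} : Set ℕ) => g i :=
    hg.comp_injective (Set.inclusion_injective Set.sdiff_subset)
  have hs : Summable fun i : ({n} : Set ℕ) => g i := Summable.of_finite
  have := hs.tsum_union_disjoint Set.disjoint_sdiff_right hd
  rw [Set.union_sdiff_cancel (Set.singleton_subset_iff.2 hn)] at this
  rw [this]
  simp

/-- Pairwise disjoint sets of integers escape to infinity. -/
theorem eventually_forall_le_of_pairwise_disjoint {A : ℕ → Set ℕ}
    (hA : ∀ k l, k ≠ l → Disjoint (A k) (A l)) (M : ℕ) :
    ∀ᶠ l in atTop, ∀ n ∈ A l, M ≤ n := by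
  have h : ∀ n ∈ Set.Iio M, ∀ᶠ l in atTop, n ∉ A l := fun n _ => by
    by_cases hn : ∃ k, n ∈ A k
    · obtain ⟨k, hk⟩ := hn
      filter_upwards [eventually_gt_atTop k] with l hl hnl
      exact Set.disjoint_left.1 (hA k l hl.ne) hk hnl
    · exact Eventually.of_forall fun l hl => hn ⟨l, hl⟩
  filter_upwards [(eventually_all_finite (Set.finite_Iio M)).2 h] with l hl n hn
  by_contra hlt
  exact hl n (not_le.1 hlt) hn

/-- In a space without isolated points a dense sequence visits every ball infinitely often. -/
theorem frequently_dist_lt_of_denseRange {E : Type*} [MetricSpace E] [∀ x : E, NeBot (𝓝[≠] x)]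
    {u : ℕ → E} (hu : DenseRange u) (z : E) {r : ℝ} (hr : 0 < r) :
    ∃ᶠ l in atTop, dist (u l) z < r := by
  refine frequently_atTop.2 fun L => ?_
  have hd : Dense (Set.range u \ (u '' Set.Iio L)) := hu.sdiff_finite ((Set.finite_Iio L).image u)
  obtain ⟨_, ⟨⟨l, rfl⟩, hl⟩, hlz⟩ := hd.exists_dist_lt z hr
  refine ⟨l, ?_, by rwa [dist_comm]⟩
  by_contra hlt
  exact hl ⟨l, not_le.1 hlt, rfl⟩

theorem exists_strictMono_natCast_ge (g : ℕ → ℝ) :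
    ∃ L : ℕ → ℕ, StrictMono L ∧ ∀ l, g l ≤ L l :=
  extraction_forall_of_eventually (P := fun l k => g l ≤ (k : ℝ))
    fun l => tendsto_natCast_atTop_atTop.eventually_ge_atTop (g l)

end General

/-! ### The criterion implies disjoint hypercyclicity -/

section Sufficiency

variable {𝕜 : Type*} [RCLike 𝕜] {X : Type*} [NormedAddCommGroup X] [NormedSpace 𝕜 X]

/-- If the `k`-th vector is moved by `Q` close to `v` and all the others close to `0`, then `Q`
moves the sum of all vectors close to `v`. -/
theorem norm_tsum_sub_le_of_geometric [CompleteSpace X] (Q : X →L[𝕜] X) {u : ℕ → X}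
    (hu : Summable u) {k : ℕ} {v : X}
    (hlt : ∀ i < k, ‖Q (u i)‖ ≤ (1 / 4) ^ k) (heq : ‖Q (u k) - v‖ ≤ 2 * (1 / 4) ^ k)
    (hgt : ∀ i, k < i → ‖Q (u i)‖ ≤ (1 / 4) ^ i) :
    ‖Q (∑' i, u i) - v‖ ≤ 4 * (1 / 2) ^ k := by
  have hQ : HasSum (fun i => Q (u i)) (Q (∑' i, u i)) := hu.hasSum.mapL Q
  have hv : HasSum (fun i => (Pi.single k v : ℕ → X) i) v := hasSum_pi_single k v
  have hsub := hQ.sub hv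
  have hg : HasSum (fun i : ℕ => (2 * (1 / 2 : ℝ) ^ k) * (1 / 2) ^ i) ((2 * (1 / 2) ^ k) * 2) :=
    hasSum_geometric_two.mul_left _
  have h4 : ∀ i : ℕ, (1 / 4 : ℝ) ^ i = (1 / 2) ^ i * (1 / 2) ^ i := fun i => by
    rw [← mul_pow]; norm_num
  rw [← hsub.tsum_eq]
  refine (tsum_of_norm_bounded hg fun i => ?_).trans (le_of_eq (by ring))
  have hpk : (0 : ℝ) < (1 / 2) ^ k := by positivity
  have hpi : (0 : ℝ) < (1 / 2) ^ i := by positivity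
  rcases lt_trichotomy i k with h | h | h
  · rw [Pi.single_eq_of_ne h.ne, sub_zero]
    have hle : (1 / 2 : ℝ) ^ k ≤ (1 / 2) ^ i :=
      pow_le_pow_of_le_one (by norm_num) (by norm_num) h.le
    have := mul_le_mul_of_nonneg_left hle hpk.le
    have := hlt i h
    rw [h4] at this
    nlinarith
  · subst h
    rw [Pi.single_eq_same]
    rw [h4] at heq
    linarith
  · rw [Pi.single_eq_of_ne h.ne', sub_zero]
    have hle : (1 / 2 : ℝ) ^ i ≤ (1 / 2) ^ k :=
      pow_le_pow_of_le_one (by norm_num) (by norm_num) h.le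
    have := mul_le_mul_of_nonneg_right hle hpi.le
    have := hgt i h
    rw [h4] at this
    nlinarith

theorem SatisfiesDisjointACriterion.disjointAHypercyclic [CompleteSpace X] [Nontrivial X] {N : ℕ}
    (hN : 0 < N) {𝒜 : Set (Set ℕ)} (hmono : ∀ A ∈ 𝒜, ∀ B, A ⊆ B → B ∈ 𝒜)
    {T : Fin N → X →L[𝕜] X} (h : SatisfiesDisjointACriterion 𝒜 T) :
    DisjointAHypercyclic 𝒜 T := by
  obtain ⟨Y₀, y, S, A, ε, hY₀, hy, hA, hdisj, -, hε, hunif, hoff, hlow, hdiag⟩ := h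
  have : Nonempty (Fin N) := ⟨⟨0, hN⟩⟩
  -- A nontrivial real normed space has no isolated points; this is needed for recurrence of the
  -- dense sequence in X^N.
  let _ : NormedSpace ℝ X := NormedSpace.restrictScalars ℝ 𝕜 X
  set z : ℕ → Fin N → X := fun l j => (y l j : X) with hz
  have hzd : DenseRange z := by
    have h1 : DenseRange fun (v : Fin N → Y₀) (j : Fin N) => (v j : X) :=
      DenseRange.piMap fun _ => hY₀.denseRange_val
    exact h1.comp hy (by fun_prop)
  set g : ℕ → ℕ → X := fun l n => S n (y l) with hg
  set ξ : ℕ → X := fun l => ∑' n : A l, g l n with hξ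
  have hsum : ∀ l, Summable fun n : A l => g l n := fun l =>
    summable_subtype_of_tail fun δ hδ => (hunif δ hδ).imp fun M hM F hF => hM l F hF
  have hTξ : ∀ (l : ℕ) (j : Fin N) (n : ℕ), (T j ^ n) (ξ l) = ∑' i : A l, (T j ^ n) (g l i) :=
    fun l j n => (T j ^ n).map_tsum (hsum l)
  have hTsum : ∀ (l : ℕ) (j : Fin N) (n : ℕ), Summable fun i : A l => (T j ^ n) (g l i) :=
    fun l j n => (hsum l).mapL (T j ^ n)
  have hξ0 : ∀ δ : ℝ, 0 < δ → ∀ᶠ l in atTop, ‖ξ l‖ ≤ δ := fun δ hδ => by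
    obtain ⟨M, hM⟩ := hunif δ hδ
    filter_upwards [eventually_forall_le_of_pairwise_disjoint hdisj M] with l hl
    exact norm_tsum_subtype_le fun F hF => hM l F fun n hn => ⟨hl n (hF n hn), hF n hn⟩
  -- The k-th index is chosen near the target `z k`, so `z ∘ φ` inherits density. Recurrence of `z`
  -- lets φ increase strictly, as `hlow` requires.
  obtain ⟨φ, hφ, hφP⟩ := extraction_forall_of_frequently
    (P := fun k l => dist (z l) (z k) < (1 / 2) ^ k ∧ ‖ξ l‖ ≤ (1 / 2) ^ k ∧ ε l ≤ (1 / 4) ^ k)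
    fun k => (frequently_dist_lt_of_denseRange hzd (z k) (by positivity)).and_eventually
      ((hξ0 _ (by positivity)).and (hε.eventually_le_const (by positivity)))
  have hξφ : Summable fun k => ξ (φ k) :=
    Summable.of_norm_bounded summable_geometric_two fun k => (hφP k).2.1
  have key : ∀ (k : ℕ) (j : Fin N), ∀ n ∈ A (φ k),
      ‖(T j ^ n) (∑' i, ξ (φ i)) - z (φ k) j‖ ≤ 4 * (1 / 2) ^ k := by
    intro k j n hn
    refine norm_tsum_sub_le_of_geometric (T j ^ n) hξφ (fun i hi => ?_) ?_ fun i hi => ?_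
    · rw [hTξ]
      exact (hlow (φ k) j n hn (φ i) (hφ hi)).trans (hφP k).2.2
    · rw [hTξ, tsum_subtype_eq_add_tsum_diff (g := fun i => (T j ^ n) (g (φ k) i)) hn (hTsum _ j n),
        add_sub_right_comm, two_mul]
      exact (norm_add_le _ _).trans (add_le_add ((hdiag (φ k) j n hn).trans (hφP k).2.2)
        ((hoff (φ k) j n (Set.mem_iUnion.2 ⟨_, hn⟩)).trans (hφP k).2.2))
    -- Since n lies outside this set, `hoff` omits nothing and bounds the whole series.
    · have hni : n ∉ A (φ i) := Set.disjoint_left.1 (hdisj _ _ (hφ.injective.ne hi.ne)) hn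
      have := hoff (φ i) j n (Set.mem_iUnion.2 ⟨_, hn⟩)
      rw [Set.sdiff_singleton_eq_self hni] at this
      rw [hTξ]
      exact this.trans (hφP i).2.2
  refine ⟨∑' i, ξ (φ i), fun U hU ⟨v, hv⟩ => ?_⟩
  obtain ⟨r, hr, hrU⟩ := Metric.isOpen_iff.1 hU v hv
  have hsmall : ∀ᶠ k : ℕ in atTop, 5 * (1 / 2 : ℝ) ^ k < r / 2 := by
    have := (tendsto_pow_atTop_nhds_zero_of_lt_one (r := (1 / 2 : ℝ)) (by norm_num)
      (by norm_num)).const_mul 5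
    rw [mul_zero] at this
    exact this.eventually_lt_const (half_pos hr)
  -- The errors are 4 · 2⁻ᵏ from `key`, 2⁻ᵏ from `z (φ k)` to `z k`, and r / 2 from `z k` to v.
  obtain ⟨k, hkv, hk⟩ :=
    ((frequently_dist_lt_of_denseRange hzd v (half_pos hr)).and_eventually hsmall).exists
  refine hmono _ (hA (φ k)) _ fun n hn => hrU ?_
  rw [directSumOp_pow_apply]
  have h1 : dist (fun s => (T s ^ n) (∑' i, ξ (φ i))) (z (φ k)) ≤ 4 * (1 / 2) ^ k :=
    (dist_pi_le_iff (by positivity)).2 fun j => by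
      rw [dist_eq_norm]
      exact key k j n hn
  have h2 := (hφP k).1
  have h3 := dist_triangle4 (fun s => (T s ^ n) (∑' i, ξ (φ i))) (z (φ k)) (z k) v
  exact lt_of_le_of_lt h3 (by linarith)

end Sufficiency

/-! ### Sequence spaces with restriction operators -/

/-- A normed space of scalar sequences that is closed under restricting a sequence to a set of
coordinates, such that restricting does not increase the norm and the tails tend to `0`. -/
structure SequenceSpace (𝕜 X : Type*) [RCLike 𝕜] [NormedAddCommGroup X] [NormedSpace 𝕜 X] where
  coord : X →ₗ[𝕜] (ℕ → 𝕜)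
  coord_injective : Function.Injective coord
  restrict : Set ℕ → X → X
  coord_restrict : ∀ D x, coord (restrict D x) = D.indicator (coord x)
  norm_restrict_le : ∀ D x, ‖restrict D x‖ ≤ ‖x‖
  tendsto_restrict_Ici : ∀ x, Tendsto (fun m : ℕ => restrict (Set.Ici m) x) atTop (𝓝 0)

namespace SequenceSpace

variable {𝕜 : Type*} [RCLike 𝕜] {X : Type*} [NormedAddCommGroup X] [NormedSpace 𝕜 X]
  (E : SequenceSpace 𝕜 X)

theorem ext {x y : X} (h : ∀ i, E.coord x i = E.coord y i) : x = y :=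
  E.coord_injective (funext h)

theorem restrict_sub (D : Set ℕ) (x y : X) :
    E.restrict D (x - y) = E.restrict D x - E.restrict D y := by
  refine E.coord_injective ?_
  rw [map_sub, E.coord_restrict, E.coord_restrict, E.coord_restrict, map_sub]
  exact Set.indicator_sub' _ _ _

theorem restrict_smul (D : Set ℕ) (c : 𝕜) (x : X) :
    E.restrict D (c • x) = c • E.restrict D x := by
  refine E.coord_injective ?_
  rw [map_smul, E.coord_restrict, E.coord_restrict, map_smul]
  exact Set.indicator_const_smul D c (E.coord x)

theorem restrict_eq_zero {D : Set ℕ} {x : X} (h : ∀ i ∈ D, E.coord x i = 0) :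
    E.restrict D x = 0 := by
  refine E.coord_injective ?_
  rw [map_zero, E.coord_restrict]
  exact funext fun i => Set.indicator_apply_eq_zero.2 (h i)

theorem restrict_eq_self {D : Set ℕ} {x : X} (h : ∀ i ∉ D, E.coord x i = 0) :
    E.restrict D x = x := by
  refine E.coord_injective ?_
  rw [E.coord_restrict]
  exact Set.indicator_eq_self.2 fun i hi => by_contra fun hD => hi (h i hD)

theorem norm_restrict_le_of_subset {D D' : Set ℕ} (h : D ⊆ D') (x : X) :
    ‖E.restrict D x‖ ≤ ‖E.restrict D' x‖ := by
  have : E.restrict D x = E.restrict D (E.restrict D' x) := by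
    refine E.coord_injective ?_
    rw [E.coord_restrict, E.coord_restrict, E.coord_restrict, Set.indicator_indicator,
      Set.inter_eq_left.2 h]
  rw [this]
  exact E.norm_restrict_le _ _

/-- Disjointness merges many blocks into one restriction, whose norm is controlled without a
triangle inequality. -/
theorem sum_restrict {D : ℕ → Set ℕ} (F : Finset ℕ) (x : X)
    (hD : (F : Set ℕ).PairwiseDisjoint D) :
    ∑ n ∈ F, E.restrict (D n) x = E.restrict (⋃ n ∈ F, D n) x := by
  refine E.coord_injective ?_
  rw [map_sum, E.coord_restrict, Finset.indicator_biUnion F D hD]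
  funext i
  rw [Finset.sum_apply]
  simp only [E.coord_restrict]

/-- The finitely supported sequences. -/
def finitelySupported : Submodule 𝕜 X where
  carrier := {x | ∃ m : ℕ, ∀ i, m ≤ i → E.coord x i = 0}
  zero_mem' := ⟨0, fun i _ => by simp⟩
  add_mem' := by
    rintro x y ⟨a, ha⟩ ⟨b, hb⟩
    exact ⟨max a b, fun i hi => by
      rw [map_add, Pi.add_apply, ha i (le_of_max_le_left hi), hb i (le_of_max_le_right hi),
        add_zero]⟩
  smul_mem' := by
    rintro c x ⟨a, ha⟩
    exact ⟨a, fun i hi => by rw [map_smul, Pi.smul_apply, ha i hi, smul_zero]⟩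

theorem dense_finitelySupported : Dense (E.finitelySupported : Set X) := by
  intro x
  have h : Tendsto (fun m : ℕ => x - E.restrict (Set.Ici m) x) atTop (𝓝 x) := by
    simpa using tendsto_const_nhds.sub (E.tendsto_restrict_Ici x)
  refine mem_closure_of_tendsto h (Eventually.of_forall fun m => ⟨m, fun i hi => ?_⟩)
  rw [map_sub, E.coord_restrict, Pi.sub_apply, Set.indicator_of_mem (Set.mem_Ici.2 hi), sub_self]

theorem pow_pseudoShift_restrict {f : ℕ → ℕ} {w : ℕ → 𝕜} {T : X →L[𝕜] X}
    (hT : ∀ x j, E.coord (T x) j = w (f j) * E.coord x (f j)) (n : ℕ) (D : Set ℕ) (x : X) :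
    (T ^ n) (E.restrict D x) = E.restrict (f^[n] ⁻¹' D) ((T ^ n) x) := by
  induction n generalizing D x with
  | zero => rfl
  | succ n ih =>
    have h1 : T (E.restrict D x) = E.restrict (f ⁻¹' D) (T x) := by
      refine E.ext fun j => ?_
      rw [hT, E.coord_restrict, E.coord_restrict]
      by_cases hj : f j ∈ D
      · rw [Set.indicator_of_mem hj, Set.indicator_of_mem (by exact hj), hT]
      · rw [Set.indicator_of_notMem hj, Set.indicator_of_notMem (by exact hj), mul_zero]
    rw [pow_succ, mul_apply_eq_comp, mul_apply_eq_comp, h1, ih]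
    rw [Function.iterate_succ', Set.preimage_comp]

end SequenceSpace

/-! ### Disjoint hypercyclicity implies the criterion -/

theorem le_iterate_of_strictMono {f : ℕ → ℕ} (hf : StrictMono f) (hf0 : 0 < f 0) (n q : ℕ) :
    n ≤ f^[n] q := by
  induction n with
  | zero => exact Nat.zero_le _
  | succ n ih =>
    rw [Function.iterate_succ_apply']
    have h : ∀ k, k < f k := fun k => by
      induction k with
      | zero => exact hf0
      | succ k ihk => exact lt_of_le_of_lt ihk (hf k.lt_succ_self)
    exact lt_of_le_of_lt ih (h _)

theorem exists_eq_of_pairwise_disjoint {X : Type*} [Nonempty X] {A : ℕ → Set ℕ}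
    (hA : ∀ k l, k ≠ l → Disjoint (A k) (A l)) (F : ℕ → ℕ → X) :
    ∃ v : ℕ → X, ∀ l, ∀ n ∈ A l, v n = F l n := by
  classical
  refine ⟨fun n => if h : ∃ l, n ∈ A l then F h.choose n else Classical.arbitrary X, fun l n hn => ?_⟩
  have h : ∃ l, n ∈ A l := ⟨l, hn⟩
  have : h.choose = l := by
    by_contra hne
    exact Set.disjoint_left.1 (hA _ _ hne) h.choose_spec hn
  simp only [dif_pos h, this]

/-- Weak partition regularity ties the segment length to the index. Placing `B l` at index `L l`,
with `B 0` as filler elsewhere, gives segments of length `L l`. -/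
theorem WeaklyPartitionRegular.exists_subset_of_injective {N : ℕ} {f : Fin N → ℕ → ℕ}
    {𝒜 : Set (Set ℕ)} (h : WeaklyPartitionRegular f 𝒜) {L : ℕ → ℕ} (hL : Function.Injective L)
    {B : ℕ → Set ℕ} (hB : ∀ l, B l ∈ 𝒜) :
    ∃ A : ℕ → Set ℕ, (∀ l, A l ∈ 𝒜) ∧ (∀ l, A l ⊆ B l) ∧
      ∀ l k : ℕ, ∀ m ∈ A l, ∀ n ∈ A k, m ≠ n → ∀ s t : Fin N,
        Disjoint ((f s)^[m] '' Set.Iio (L l)) ((f t)^[n] '' Set.Iio (L k)) := by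
  obtain ⟨A, hA, hAB, hd⟩ := h (Function.extend L B fun _ => B 0) fun q => by
    by_cases hq : ∃ l, L l = q
    · obtain ⟨l, rfl⟩ := hq
      rw [hL.extend_apply]
      exact hB l
    · rw [Function.extend_apply' _ _ _ hq]
      exact hB 0
  refine ⟨A ∘ L, fun l => hA _, fun l => ?_, fun l k m hm n hn hmn s t =>
    Set.disjoint_iff_inter_eq_empty.2 (hd _ _ m hm n hn hmn s t)⟩
  have := hAB (L l)
  rwa [hL.extend_apply] at this

section Necessity

variable {𝕜 : Type*} [RCLike 𝕜] {X : Type*} [NormedAddCommGroup X] [NormedSpace 𝕜 X]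

/-- Return sets are nonempty because ∅ ∉ 𝒜, so the orbit of (x, …, x) is dense in X^N; project to
one coordinate. -/
theorem DisjointAHypercyclic.separableSpace {N : ℕ} (hN : 0 < N) {𝒜 : Set (Set ℕ)}
    (h𝒜 : ∅ ∉ 𝒜) {T : Fin N → X →L[𝕜] X} (h : DisjointAHypercyclic 𝒜 T) :
    TopologicalSpace.SeparableSpace X := by
  obtain ⟨x, hx⟩ := h
  have hd : DenseRange fun n : ℕ => (directSumOp T ^ n) fun _ => x := by
    refine dense_iff_inter_open.2 fun U hU hne => ?_
    by_contra hcon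
    refine h𝒜 ?_
    have hmem := hx U hU hne
    have he : {n : ℕ | (directSumOp T ^ n) (fun _ => x) ∈ U} = ∅ :=
      Set.eq_empty_of_forall_notMem fun n hn => hcon ⟨_, hn, ⟨n, rfl⟩⟩
    rwa [he] at hmem
  have : TopologicalSpace.SeparableSpace (Fin N → X) := ⟨_, Set.countable_range _, hd⟩
  exact (Function.surjective_eval (β := fun _ : Fin N => X) ⟨0, hN⟩).denseRange.separableSpace
    (continuous_apply _)

/-- A separable nontrivial normed space has a dense sequence of nonzero vectors. -/
theorem exists_denseRange_ne_zero (𝕜 : Type*) [RCLike 𝕜] (V : Type*) [NormedAddCommGroup V]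
    [NormedSpace 𝕜 V] [Nontrivial V] [TopologicalSpace.SeparableSpace V] :
    ∃ y : ℕ → V, DenseRange y ∧ ∀ l, y l ≠ 0 := by
  have : SecondCountableTopology V := UniformSpace.secondCountable_of_separable V
  have : NeBot (𝓝[≠] (0 : V)) := Module.punctured_nhds_neBot 𝕜 V 0
  obtain ⟨t, ht0, htc, htd⟩ := (dense_compl_singleton (0 : V)).exists_countable_dense_subset
  obtain ⟨y, rfl⟩ := htc.exists_eq_range htd.nonempty
  exact ⟨y, htd, fun l => ht0 ⟨l, rfl⟩⟩

theorem DisjointAHypercyclic.satisfiesDisjointACriterion [Nontrivial X] (E : SequenceSpace 𝕜 X)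
    {N : ℕ} (hN : 0 < N) {f : Fin N → ℕ → ℕ} (hf : ∀ s, StrictMono (f s))
    (hf0 : ∀ s, 0 < f s 0) {w : Fin N → ℕ → 𝕜} {𝒜 : Set (Set ℕ)} (h𝒜 : ∅ ∉ 𝒜)
    (hreg : WeaklyPartitionRegular f 𝒜) {T : Fin N → X →L[𝕜] X}
    (hT : ∀ s x j, E.coord (T s x) j = w s (f s j) * E.coord x (f s j))
    (h : DisjointAHypercyclic 𝒜 T) : SatisfiesDisjointACriterion 𝒜 T := by
  have : Nonempty (Fin N) := ⟨⟨0, hN⟩⟩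
  have := h.separableSpace hN h𝒜
  have : SecondCountableTopology X := UniformSpace.secondCountable_of_separable X
  obtain ⟨x, hx⟩ := h
  have : Nontrivial E.finitelySupported := by
    obtain ⟨a, ha⟩ := exists_ne (0 : X)
    obtain ⟨b, hb, hba⟩ := E.dense_finitelySupported.exists_dist_lt a (norm_pos_iff.2 ha)
    refine ⟨⟨⟨b, hb⟩, 0, fun h0 => ?_⟩⟩
    have hb0 : b = 0 := congrArg Subtype.val h0
    rw [hb0, dist_zero_right] at hba
    exact lt_irrefl _ hba
  obtain ⟨y, hyd, hy0⟩ := exists_denseRange_ne_zero 𝕜 (Fin N → E.finitelySupported)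
  set u : ℕ → Fin N → X := fun l j => (y l j : X) with hu
  have hu0 : ∀ l, u l ≠ 0 := fun l h0 => hy0 l (funext fun j => Subtype.ext (congrFun h0 j))
  have hsupp : ∀ l, ∃ m : ℕ, ∀ j, ∀ i, m ≤ i → E.coord (u l j) i = 0 := fun l => by
    choose m hm using fun j => (y l j).2
    exact ⟨Finset.univ.sup m, fun j i hi => hm j i ((Finset.le_sup (Finset.mem_univ j)).trans hi)⟩
  choose m hm using hsupp
  -- `L l` must cover the supports of `u l`, force `C l ≥ l + 1`, and grow strictly to separate the
  -- targets.
  obtain ⟨L, hL, hLge⟩ :=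
    exists_strictMono_natCast_ge fun l => max (m l : ℝ) ((l + 1) * ‖u l‖)
  have hmL : ∀ l, m l ≤ L l := fun l => by exact_mod_cast (le_max_left _ _).trans (hLge l)
  have huL : ∀ l, (l + 1) * ‖u l‖ ≤ L l := fun l => (le_max_right _ _).trans (hLge l)
  have hupos : ∀ l, 0 < ‖u l‖ := fun l => norm_pos_iff.2 (hu0 l)
  -- the targets `C l • u l` have norm `2 * L l`
  set C : ℕ → ℝ := fun l => 2 * L l / ‖u l‖ with hC
  have hCl : ∀ l : ℕ, (l : ℝ) + 1 ≤ C l := fun l => by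
    rw [hC, le_div_iff₀ (hupos l)]
    have := huL l
    have : (0 : ℝ) ≤ L l := Nat.cast_nonneg _
    linarith
  have hCpos : ∀ l, 0 < C l := fun l => lt_of_lt_of_le (by positivity) (hCl l)
  have hCnorm : ∀ l, ‖((C l : ℝ) : 𝕜) • u l‖ = 2 * L l := fun l => by
    rw [norm_smul, RCLike.norm_ofReal, abs_of_pos (hCpos l), hC, div_mul_cancel₀ _ (hupos l).ne']
  set ε : ℕ → ℝ := fun l => 1 / ((l : ℝ) + 1) with hε
  have hεpos : ∀ l, 0 < ε l := fun l => by positivity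
  have hεone : ∀ l, ε l ≤ 1 := fun l => by
    rw [hε, div_le_one (by positivity)]
    have : (0 : ℝ) ≤ l := Nat.cast_nonneg _
    linarith
  have hCinv : ∀ l, (C l)⁻¹ ≤ ε l := fun l => by
    simp only [hε, one_div]
    exact inv_anti₀ (by positivity) (hCl l)
  have hCinv_one : ∀ l, (C l)⁻¹ ≤ 1 := fun l => (hCinv l).trans (hεone l)
  set B : ℕ → Set ℕ := fun l =>
    {n | (directSumOp T ^ n) (fun _ => x) ∈ Metric.ball (((C l : ℝ) : 𝕜) • u l) (ε l)} with hB
  have hB𝒜 : ∀ l, B l ∈ 𝒜 := fun l =>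
    hx _ Metric.isOpen_ball (Metric.nonempty_ball.2 (hεpos l))
  have hBnear : ∀ l, ∀ n ∈ B l, ∀ j, ‖(T j ^ n) x - ((C l : ℝ) : 𝕜) • u l j‖ ≤ ε l := by
    intro l n hn j
    have h1 : dist ((directSumOp T ^ n) fun _ => x) (((C l : ℝ) : 𝕜) • u l) ≤ ε l :=
      (Metric.mem_ball.1 hn).le
    rw [directSumOp_pow_apply] at h1
    have := (dist_le_pi_dist _ _ j).trans h1
    rwa [dist_eq_norm] at this
  -- The centres have norms 2 L k and 2 L l, at least 2 apart, while the open balls have radii at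
  -- most 1.
  have hBdisj : ∀ k l, k < l → Disjoint (B k) (B l) := by
    intro k l hkl
    refine Set.disjoint_left.2 fun n hk hl => ?_
    have h1 := (dist_triangle_left (((C l : ℝ) : 𝕜) • u l) (((C k : ℝ) : 𝕜) • u k)
      ((directSumOp T ^ n) fun _ => x)).trans_lt
      (add_lt_add (Metric.mem_ball.1 hl) (Metric.mem_ball.1 hk))
    have h2 := norm_sub_norm_le (((C l : ℝ) : 𝕜) • u l) (((C k : ℝ) : 𝕜) • u k)
    rw [hCnorm, hCnorm, ← dist_eq_norm] at h2
    have h3 : (L k : ℝ) + 1 ≤ L l := by exact_mod_cast hL hkl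
    linarith [hεone k, hεone l]
  obtain ⟨A, hA𝒜, hAB, hAd⟩ := hreg.exists_subset_of_injective hL.injective hB𝒜
  have hAdisj : ∀ k l, k ≠ l → Disjoint (A k) (A l) := fun k l hkl =>
    (hkl.lt_or_gt.elim (hBdisj k l) fun h => (hBdisj l k h).symm).mono (hAB k) (hAB l)
  set D : ℕ → ℕ → Set ℕ := fun l n => ⋃ t, (f t)^[n] '' Set.Iio (L l) with hD
  -- As the `A l` are disjoint, n determines l, so S_n may ignore its vector argument.
  obtain ⟨v, hv⟩ := exists_eq_of_pairwise_disjoint (X := X) hAdisj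
    fun l n => (((C l)⁻¹ : ℝ) : 𝕜) • E.restrict (D l n) x
  have hDdisj : ∀ l, (A l).PairwiseDisjoint (D l) := fun l a ha b hb hab =>
    Set.disjoint_iUnion_left.2 fun s => Set.disjoint_iUnion_right.2 fun t =>
      hAd l l a ha b hb hab s t
  have hsum : ∀ l, ∀ F : Finset ℕ, (∀ n ∈ F, n ∈ A l) →
      ∑ n ∈ F, v n = (((C l)⁻¹ : ℝ) : 𝕜) • E.restrict (⋃ n ∈ F, D l n) x := by
    intro l F hF
    rw [← E.sum_restrict F x ((hDdisj l).subset hF), Finset.smul_sum]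
    exact Finset.sum_congr rfl fun n hn => hv l n (hF n hn)
  have hnorm : ∀ l, ∀ a : X, ‖(((C l)⁻¹ : ℝ) : 𝕜) • a‖ = (C l)⁻¹ * ‖a‖ := fun l a => by
    rw [norm_smul, RCLike.norm_ofReal, abs_of_pos (inv_pos.2 (hCpos l))]
  -- One estimate serves both off-diagonal clauses: `(C l)⁻¹` supplies the smallness when the bound
  -- must be `ε l`, and `ε k` when the bound follows the set containing n.
  have hcross : ∀ l k j, ∀ n ∈ A k, ∀ F : Finset ℕ, (∀ i ∈ F, i ∈ A l \ {n}) →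
      ‖∑ i ∈ F, (T j ^ n) (v i)‖ ≤ (C l)⁻¹ * ε k := by
    intro l k j n hn F hF
    rw [← map_sum, hsum l F fun i hi => (hF i hi).1, map_smul, E.pow_pseudoShift_restrict (hT j),
      hnorm]
    refine mul_le_mul_of_nonneg_left ?_ (inv_pos.2 (hCpos l)).le
    -- The blocks of times i ≠ n miss f_j^n([L k]), so their preimage misses the support of `u k j`;
    -- subtracting `C k • u k j` there is free.
    have hzero : E.restrict ((f j)^[n] ⁻¹' ⋃ i ∈ F, D l i) (((C k : ℝ) : 𝕜) • u k j) = 0 := by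
      rw [E.restrict_smul, E.restrict_eq_zero, smul_zero]
      intro q hq
      refine hm k j q ((hmL k).trans ?_)
      by_contra hlt
      obtain ⟨i, hi, hqi⟩ := Set.mem_iUnion₂.1 hq
      obtain ⟨t, ht⟩ := Set.mem_iUnion.1 hqi
      exact Set.disjoint_left.1 (hAd l k i (hF i hi).1 n hn (hF i hi).2 t j) ht
        ⟨q, not_le.1 hlt, rfl⟩
    rw [← sub_zero (E.restrict _ ((T j ^ n) x)), ← hzero, ← E.restrict_sub]
    exact (E.norm_restrict_le _ _).trans (hBnear k n (hAB k hn) j)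
  refine ⟨E.finitelySupported, y, fun n _ => v n, A, ε, E.dense_finitelySupported, hyd, hA𝒜,
    hAdisj, hεpos, tendsto_one_div_add_atTop_nhds_zero_nat, ?_, ?_, ?_, ?_⟩
  · intro δ hδ
    have htail := (E.tendsto_restrict_Ici x).norm
    rw [norm_zero] at htail
    obtain ⟨M, hM⟩ := (htail.eventually_le_const hδ).exists
    refine ⟨M, fun l F hF => ?_⟩
    rw [hsum l F fun n hn => (hF n hn).2, hnorm]
    refine (mul_le_of_le_one_left (norm_nonneg _) (hCinv_one l)).trans
      ((E.norm_restrict_le_of_subset (Set.iUnion₂_subset fun n hn => ?_) x).trans hM)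
    -- Since f_t^n(q) ≥ n, blocks with n ≥ M lie in the tail [M, ∞), whatever l is.
    refine Set.iUnion_subset fun t => ?_
    rintro _ ⟨q, -, rfl⟩
    exact (hF n hn).1.trans (le_iterate_of_strictMono (hf t) (hf0 t) n q)
  · intro l j n hn
    obtain ⟨k, hk⟩ := Set.mem_iUnion.1 hn
    refine norm_tsum_subtype_le (g := fun i => (T j ^ n) (v i)) fun F hF =>
      (hcross l k j n hk F hF).trans ?_
    exact (mul_le_of_le_one_right (inv_pos.2 (hCpos l)).le (hεone k)).trans (hCinv l)
  · intro l j n hn k hkl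
    refine norm_tsum_subtype_le (g := fun i => (T j ^ n) (v i)) fun F hF =>
      (hcross k l j n hn F fun i hi => ⟨hF i hi, ?_⟩).trans
        (mul_le_of_le_one_left (hεpos l).le (hCinv_one k))
    rintro rfl
    exact Set.disjoint_left.1 (hAdisj k l hkl.ne) (hF i hi) hn
  · intro l j n hn
    -- The preimage of the block of n under f_j^n contains [L l], hence the support of `u l j`.
    have hself : E.restrict ((f j)^[n] ⁻¹' D l n) (u l j) = u l j :=
      E.restrict_eq_self fun q hq => hm l j q <| (hmL l).trans <| by
        by_contra hlt
        exact hq (Set.mem_iUnion.2 ⟨j, q, not_le.1 hlt, rfl⟩)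
    have hCne : ((C l : ℝ) : 𝕜) ≠ 0 := RCLike.ofReal_ne_zero.2 (hCpos l).ne'
    have hrw : (T j ^ n) (v n) - u l j = (((C l)⁻¹ : ℝ) : 𝕜) •
        E.restrict ((f j)^[n] ⁻¹' D l n) ((T j ^ n) x - ((C l : ℝ) : 𝕜) • u l j) := by
      rw [hv l n hn, map_smul, E.pow_pseudoShift_restrict (hT j), E.restrict_sub, E.restrict_smul,
        hself, smul_sub, smul_smul, RCLike.ofReal_inv, inv_mul_cancel₀ hCne, one_smul]
    change ‖(T j ^ n) (v n) - u l j‖ ≤ ε l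
    rw [hrw, hnorm]
    exact (mul_le_of_le_one_left (norm_nonneg _) (hCinv_one l)).trans
      ((E.norm_restrict_le _ _).trans (hBnear l n (hAB l hn) j))

end Necessity

/-! ### The spaces `c₀` and `ℓ^p` -/

section Spaces

variable {𝕜 : Type*} [RCLike 𝕜]

theorem ZeroAtInftyContinuousMap.norm_le_of_forall_le {x : C₀(ℕ, 𝕜)}
    {c : ℝ} (hc : 0 ≤ c) (h : ∀ i, ‖x i‖ ≤ c) : ‖x‖ ≤ c := by
  rw [← ZeroAtInftyContinuousMap.norm_toBCF_eq_norm]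
  exact (BoundedContinuousFunction.norm_le hc).2 h

theorem ZeroAtInftyContinuousMap.norm_apply_le (x : C₀(ℕ, 𝕜)) (i : ℕ) :
    ‖x i‖ ≤ ‖x‖ := by
  rw [← ZeroAtInftyContinuousMap.norm_toBCF_eq_norm]
  exact x.toBCF.norm_coe_le_norm i

/-- The restriction of a null sequence to a set of coordinates. -/
noncomputable def c0Restrict (D : Set ℕ) (x : C₀(ℕ, 𝕜)) : C₀(ℕ, 𝕜) where
  toFun := D.indicator x
  continuous_toFun := continuous_of_discreteTopology
  zero_at_infty' := by
    refine squeeze_zero_norm (norm_indicator_le_norm_self x) ?_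
    simpa using (zero_at_infty x).norm

/-- The restriction of an `ℓ^p` sequence to a set of coordinates. -/
noncomputable def lpRestrict {p : ℝ≥0∞} (D : Set ℕ) (x : lp (fun _ : ℕ => 𝕜) p) :
    lp (fun _ : ℕ => 𝕜) p :=
  ⟨D.indicator x, (lp.memℓp x).mono' fun i => norm_indicator_le_norm_self x i⟩

variable (𝕜)

/-- The sequence space `c₀`. -/
noncomputable def c0SequenceSpace : SequenceSpace 𝕜 C₀(ℕ, 𝕜) where
  coord :=
    { toFun := fun x => x
      map_add' := fun _ _ => rfl
      map_smul' := fun _ _ => rfl }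
  coord_injective := DFunLike.coe_injective
  restrict := c0Restrict
  coord_restrict := fun _ _ => rfl
  norm_restrict_le := fun D x =>
    ZeroAtInftyContinuousMap.norm_le_of_forall_le (norm_nonneg _) fun i =>
      (norm_indicator_le_norm_self x i).trans (x.norm_apply_le i)
  tendsto_restrict_Ici := fun x => by
    refine Metric.tendsto_atTop.2 fun δ hδ => ?_
    have hx := (zero_at_infty x).norm
    rw [cocompact_eq_cofinite, Nat.cofinite_eq_atTop, norm_zero] at hx
    obtain ⟨M, hM⟩ := eventually_atTop.1 (hx.eventually_le_const (half_pos hδ))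
    refine ⟨M, fun m hm => ?_⟩
    rw [dist_zero_right]
    refine lt_of_le_of_lt ?_ (half_lt_self hδ)
    refine ZeroAtInftyContinuousMap.norm_le_of_forall_le (half_pos hδ).le fun i => ?_
    change ‖(Set.Ici m).indicator x i‖ ≤ δ / 2
    by_cases hi : i ∈ Set.Ici m
    · rw [Set.indicator_of_mem hi]
      exact hM i (hm.trans hi)
    · rw [Set.indicator_of_notMem hi, norm_zero]
      exact (half_pos hδ).le

instance : Nontrivial C₀(ℕ, 𝕜) := by
  let e : C₀(ℕ, 𝕜) :=
    { toFun := Pi.single 0 1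
      continuous_toFun := continuous_of_discreteTopology
      zero_at_infty' := by
        rw [cocompact_eq_cofinite, Nat.cofinite_eq_atTop]
        refine tendsto_const_nhds.congr' ?_
        filter_upwards [eventually_gt_atTop 0] with i hi
        exact (Pi.single_eq_of_ne (M := fun _ : ℕ => 𝕜) hi.ne' 1).symm }
  refine ⟨⟨e, 0, fun h => ?_⟩⟩
  have h0 : (Pi.single 0 1 : ℕ → 𝕜) 0 = 0 := congrArg (fun x : C₀(ℕ, 𝕜) => x 0) h
  rw [Pi.single_eq_same] at h0
  exact one_ne_zero h0

variable (p : ℝ≥0∞) [Fact (1 ≤ p)]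

/-- The sequence space `ℓ^p`, `1 ≤ p < ∞`. -/
noncomputable def lpSequenceSpace (hp : p ≠ ⊤) : SequenceSpace 𝕜 (lp (fun _ : ℕ => 𝕜) p) where
  coord :=
    { toFun := fun x => x
      map_add' := fun _ _ => rfl
      map_smul' := fun _ _ => rfl }
  coord_injective := Subtype.val_injective
  restrict := lpRestrict
  coord_restrict := fun _ _ => rfl
  norm_restrict_le := fun D x =>
    lp.norm_mono (zero_lt_one.trans_le Fact.out).ne' fun i => norm_indicator_le_norm_self x i
  tendsto_restrict_Ici := fun x => by
    -- The restriction to [m, ∞) is x minus the m-th partial sum of its unit vector expansion, which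
    -- converges because p < ∞.
    have h := (lp.hasSum_single hp x).tendsto_sum_nat.const_sub x
    rw [sub_self] at h
    refine h.congr fun m => lp.ext (funext fun i => ?_)
    change x i - (∑ j ∈ Finset.range m, lp.single p j (x j) : lp (fun _ : ℕ => 𝕜) p) i
      = (Set.Ici m).indicator x i
    rw [lp.coeFn_sum, Finset.sum_apply]
    simp only [lp.single_apply, Finset.sum_pi_single, Finset.mem_range, Set.indicator_apply,
      Set.mem_Ici]
    by_cases hi : i < m
    · rw [if_pos hi, if_neg (not_le.2 hi), sub_self]
    · rw [if_neg hi, if_pos (not_lt.1 hi), sub_zero]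

instance : Nontrivial (lp (fun _ : ℕ => 𝕜) p) := by
  refine ⟨⟨lp.single p 0 (1 : 𝕜), 0, fun h => ?_⟩⟩
  have h0 := congrArg (fun x : lp (fun _ : ℕ => 𝕜) p => x 0) h
  simp at h0

end Spaces

theorem mainTheorem4 {𝕜 : Type*} [RCLike 𝕜] {N : ℕ} (hN : 2 ≤ N)
    (f : Fin N → ℕ → ℕ) (hf : ∀ s, StrictMono (f s)) (hf0 : ∀ s, 0 < f s 0)
    (w : Fin N → ℕ → 𝕜) (hw : ∀ s, BddAbove (Set.range fun j => ‖w s (f s j)‖))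
    (𝒜 : Set (Set ℕ)) (h𝒜 : 𝒜 = familyUBd ∨ 𝒜 = familyUd ∨ 𝒜 = familyLd)
    (hreg : WeaklyPartitionRegular f 𝒜) :
    (DisjointAHypercyclic 𝒜 (fun s => c0PseudoShift (f s) (hf s) (w s) (hw s)) ↔
      SatisfiesDisjointACriterion 𝒜 (fun s => c0PseudoShift (f s) (hf s) (w s) (hw s))) ∧
    ∀ (p : ℝ≥0∞) [Fact (1 ≤ p)] (hp : p ≠ ⊤),
      (DisjointAHypercyclic 𝒜 (fun s => lpPseudoShift p hp (f s) (hf s) (w s) (hw s)) ↔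
        SatisfiesDisjointACriterion 𝒜
          (fun s => lpPseudoShift p hp (f s) (hf s) (w s) (hw s))) := by
  have hN0 : 0 < N := zero_lt_two.trans_le hN
  have hmono : ∀ A ∈ 𝒜, ∀ B, A ⊆ B → B ∈ 𝒜 := fun A hA B h => mem_density_family_mono h𝒜 hA h
  have hempty := empty_notMem_density_family h𝒜
  refine ⟨⟨fun h => ?_, fun h => h.disjointAHypercyclic hN0 hmono⟩,
    fun p _ hp => ⟨fun h => ?_, fun h => h.disjointAHypercyclic hN0 hmono⟩⟩
  · exact h.satisfiesDisjointACriterion (c0SequenceSpace 𝕜) hN0 hf hf0 hempty hreg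
      (w := w) fun s x j => c0PseudoShift_apply (f s) (hf s) (w s) (hw s) x j
  · exact h.satisfiesDisjointACriterion (lpSequenceSpace 𝕜 p hp) hN0 hf hf0 hempty hreg
      (w := w) fun s x j => lpPseudoShift_apply p hp (f s) (hf s) (w s) (hw s) x j
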